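/- Consider a D2D network whose interfering transmitters, seen from a typical receiver at the origin of $\mathbb{R}^2$, form a homogeneous Poisson point process $\{z_i\}$ of intensity $\mu\mathcal{P}_\delta\lambda$, where $\delta\in\{\mathrm{HD},\mathrm{FD}\}$ is the operation mode (half or full duplex), $\lambda>0$ is the user density, $\mu>0$ the fraction of active users and $\mathcal{P}_\delta>0$ the probability of operating in mode $\delta$. The channel power gains $h$ (desired link) and $h_i$ (interferers) are i.i.d. exponential with mean $1$ and independent of the point process, all transmitters use power $\rho_d>0$, the desired transmitter is at distance $\mathcal{R}_d>0$, $\alpha$ is the path-loss exponent, $\sigma^2$ the noise power and $\beta$ the residual self-interference ratio. Put $\mathbb{1}_{\mathrm{HD}}=0$, $\mathbb{1}_{\mathrm{FD}}=1$, $\kappa=1$ for HD and $\kappa=2$ for FD, and $$I=\sum_i \rho_d h_i\|z_i\|^{-\alpha},\quad \mathcal{L}_I(s)=\mathbb{E}[e^{-sI}],\quad \Upsilon^\delta=\frac{\rho_d h\mathcal{R}_d^{-\alpha}}{\sigma^2+I+\mathbb{1}_\delta\beta\rho_d},\quad \mathcal{S}_\delta=\kappa\,\mathbb{E}[\log_2(1+\Upsilon^\delta)].$$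 If $\sigma^2=0$, $\alpha=4$ and $\beta=0$, then $I<\infty$ almost surely, the expectation defining $\mathcal{S}_\delta$ is finite, the integral below converges, and $$\mathcal{S}_\delta=\frac{\kappa}{\ln 2}\int_0^\infty \frac{e^{-(\sigma^2+\mathbb{1}_\delta\beta\rho_d)\mathcal{R}_d^{\alpha}\tau/\rho_d}}{1+\tau}\,\mathcal{L}_I\!\left(\frac{\tau\mathcal{R}_d^{\alpha}}{\rho_d}\right)d\tau=\frac{\kappa}{\ln 2}\Big(\big[\pi-2\,\mathrm{Si}(T)\big]\sin T-2\,\mathrm{ci}(T)\cos T\Big),$$ where $T=\frac{\pi^2}{2}\mu\mathcal{P}_\delta\lambda\mathcal{R}_d^2$, $\mathrm{Si}(x)=\int_0^x\frac{\sin t}{t}\,dt$ and $\mathrm{ci}(x)=-\int_x^\infty\frac{\cos t}{t}\,dt$ (a convergent improper integral for $x>0$). -/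

import Mathlib

open MeasureTheory ProbabilityTheory Set Filter Topology
open scoped ENNReal NNReal

noncomputable section

/-- The plane in which the user devices live, with its Euclidean norm. -/
abbrev Plane : Type := EuclideanSpace ℝ (Fin 2)

/-- The D2D operation mode `δ`: half duplex or full duplex. -/
inductive D2DMode : Type
  | HD : D2DMode
  | FD : D2DMode

/-- The indicator `𝟙_δ`: `1` in full-duplex mode and `0` in half-duplex mode. -/
def D2DMode.ind : D2DMode → ℝ
  | .HD => 0
  | .FD => 1

/-- The number `κ` of simultaneous links: `1` in half-duplex mode and `2` in full-duplex mode. -/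
def D2DMode.kappa : D2DMode → ℝ
  | .HD => 1
  | .FD => 2

/-- The random counting measure `∑ᵢ δ_{Zᵢ}` of a point process with points `Z 0, Z 1, …`. -/
def countingMeasure {Ω : Type*} (Z : ℕ → Ω → Plane) (ω : Ω) : Measure Plane :=
  Measure.sum fun i => Measure.dirac (Z i ω)

/-- The points `Z 0, Z 1, …` form a homogeneous Poisson point process of intensity `Λ` in the plane
(with `Λ > 0` such a process has infinitely many points almost surely, so it can be enumerated by
`ℕ`): the number of points in a set of finite area is Poisson distributed with mean `Λ` times the
area, and the numbers of points in disjoint sets are independent. -/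
structure IsPoissonPointProcess {Ω : Type*} [MeasurableSpace Ω] (P : Measure Ω)
    (Z : ℕ → Ω → Plane) (Λ : ℝ) : Prop where
  measurable : ∀ i, Measurable (Z i)
  count_law : ∀ A : Set Plane, MeasurableSet A → volume A ≠ ∞ →
    HasLaw (fun ω => countingMeasure Z ω A)
      ((poissonMeasure (ENNReal.ofReal Λ * volume A).toNNReal).map (fun k : ℕ => (k : ℝ≥0∞))) P
  count_indep : ∀ (n : ℕ) (A : Fin n → Set Plane), (∀ j, MeasurableSet (A j)) →
    (∀ j, volume (A j) ≠ ∞) → Pairwise (fun j k => Disjoint (A j) (A k)) →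
    iIndepFun (fun j ω => countingMeasure Z ω (A j)) P

/-- The random environment of the typical receiver at the origin: the interfering transmitters
`Z i` form a Poisson point process of intensity `Λ`; the power gain `h₀` of the desired channel and
the power gains `h i` of the interfering channels (Rayleigh fading) are exponentially distributed
with unit mean, mutually independent, and independent of the positions. -/
structure IsD2DEnvironment {Ω : Type*} [MeasurableSpace Ω] (P : Measure Ω)
    (Z : ℕ → Ω → Plane) (h : ℕ → Ω → ℝ) (h₀ : Ω → ℝ) (Λ : ℝ) : Prop where
  ppp : IsPoissonPointProcess P Z Λ
  measurable_h : ∀ i, Measurable (h i)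
  measurable_h₀ : Measurable h₀
  law_h : ∀ i, HasLaw (h i) (expMeasure 1) P
  law_h₀ : HasLaw h₀ (expMeasure 1) P
  indep_h : iIndepFun h P
  indep_h_Z : IndepFun (fun ω i => h i ω) (fun ω i => Z i ω) P
  indep_h₀ : IndepFun h₀ (fun ω => ((fun i => h i ω, fun i => Z i ω) : (ℕ → ℝ) × (ℕ → Plane))) P

/-- The interference `∑ᵢ ρ hᵢ ‖Zᵢ‖^(-α)` at the origin, as an extended nonnegative number. -/
def interference {Ω : Type*} (ρ α : ℝ) (Z : ℕ → Ω → Plane) (h : ℕ → Ω → ℝ) (ω : Ω) : ℝ≥0∞ :=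
  ∑' i, ENNReal.ofReal (ρ * h i ω * ‖Z i ω‖ ^ (-α))

/-- The signal-to-interference-plus-noise ratio
`Υ^δ = ρ h₀ R^(-α) / (σ² + I + 𝟙_δ β ρ)` at the typical receiver. -/
def sinr {Ω : Type*} (δ : D2DMode) (σ2 β ρ R α : ℝ) (Z : ℕ → Ω → Plane) (h : ℕ → Ω → ℝ)
    (h₀ : Ω → ℝ) (ω : Ω) : ℝ :=
  ρ * h₀ ω * R ^ (-α) / (σ2 + (interference ρ α Z h ω).toReal + δ.ind * (β * ρ))

/-- The spectral efficiency `S_δ = κ 𝔼[log₂(1 + Υ^δ)]` of a D2D link. -/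
def spectralEfficiency {Ω : Type*} [MeasurableSpace Ω] (P : Measure Ω) (δ : D2DMode)
    (σ2 β ρ R α : ℝ) (Z : ℕ → Ω → Plane) (h : ℕ → Ω → ℝ) (h₀ : Ω → ℝ) : ℝ :=
  δ.kappa * ∫ ω, Real.logb 2 (1 + sinr δ σ2 β ρ R α Z h h₀ ω) ∂P

/-- The Laplace transform `𝓛_I(s) = 𝔼[exp(-s I)]` of the interference. -/
def laplaceInterference {Ω : Type*} [MeasurableSpace Ω] (P : Measure Ω) (ρ α : ℝ)
    (Z : ℕ → Ω → Plane) (h : ℕ → Ω → ℝ) (s : ℝ) : ℝ :=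
  ∫ ω, Real.exp (-s * (interference ρ α Z h ω).toReal) ∂P

/-- The integrand
`exp(-(σ² + 𝟙_δ β ρ) R^α τ / ρ) / (1 + τ) * 𝓛_I(τ R^α / ρ)` of the spectral efficiency integral. -/
def seIntegrand {Ω : Type*} [MeasurableSpace Ω] (P : Measure Ω) (δ : D2DMode)
    (σ2 β ρ R α : ℝ) (Z : ℕ → Ω → Plane) (h : ℕ → Ω → ℝ) (τ : ℝ) : ℝ :=
  Real.exp (-(σ2 + δ.ind * (β * ρ)) * R ^ α / ρ * τ) / (1 + τ)
    * laplaceInterference P ρ α Z h (τ * R ^ α / ρ)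

/-- The sine integral `Si(x) = ∫₀ˣ sin t / t dt`. -/
def Si (x : ℝ) : ℝ := ∫ t in (0 : ℝ)..x, Real.sin t / t

/-- The cosine integral `ci(x) = -∫ₓ^∞ cos t / t dt`, an improper integral. It is used for `x > 0`
only, where the limit exists. -/
def ci (x : ℝ) : ℝ := -limUnder atTop fun b : ℝ => ∫ t in x..b, Real.cos t / t

/-- The closed form `κ / ln 2 * ([π - 2 Si(T)] sin T - 2 ci(T) cos T)`. -/
def seClosedForm (δ : D2DMode) (T : ℝ) : ℝ :=
  δ.kappa / Real.log 2 *
    ((Real.pi - 2 * Si T) * Real.sin T - 2 * ci T * Real.cos T)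

end

/-! Without noise and self-interference, the event Υ > τ is, almost surely, h₀ > s I with s = τ R⁴ /
ρ. As h₀ is exponential and independent of I, its probability is 𝔼[exp(-s I)]. Writing log(1 + Υ) as
the integral of 1 / (1 + τ) over [0, Υ] and exchanging the order of integration gives the integral
of 𝓛_I(s) / (1 + τ) (`lintegral_log_one_add_sinr`).

For the transform, averaging over the fading replaces each factor exp(-w hᵢ) by 1 / (1 + w) =
exp(-log(1 + w)) (`lintegral_fading`). The Laplace functional of the Poisson process
(`laplace_functional`) then gives the exponent Λ ∫ (1 - 1 / (1 + a² ‖x‖⁻⁴)) dx with a² = s ρ. Polar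
coordinates and an arctangent evaluate it as Λ a π² / 2, which is T √τ.

What is left is the integral of exp(-T √τ) / (1 + τ), equal to 2 `auxCos T` by τ = x². The tails of
the cosine and sine integrals from T arise from (`auxCos T`, `auxSin T`) by a rotation through T
(`tendsto_integral_div_add` and a shift). Inverting the rotation gives the closed form
(`closedForm_eq_two_mul_auxCos`).

Sums and expectations live in [0, ∞], where `negExp` is continuous and at most 1. Hence no limit
needs prior knowledge that I is finite; that is deduced from the transform. -/

/-! ### The exponential exp(-x) on [0, ∞] -/

/-- The function `x ↦ exp (-x)` on the extended nonnegative reals. -/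
noncomputable def negExp (x : ℝ≥0∞) : ℝ≥0∞ := EReal.exp (-(x : EReal))

lemma continuous_negExp : Continuous negExp :=
  ENNReal.continuous_exp.comp (continuous_neg.comp continuous_coe_ennreal_ereal)

lemma measurable_negExp : Measurable negExp := continuous_negExp.measurable

@[simp] lemma negExp_zero : negExp 0 = 1 := by simp [negExp]

@[simp] lemma negExp_top : negExp ∞ = 0 := by simp [negExp]

lemma antitone_negExp : Antitone negExp := fun _ _ hab =>
  EReal.exp_monotone (EReal.neg_le_neg_iff.2 (EReal.coe_ennreal_le_coe_ennreal_iff.2 hab))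

lemma negExp_le_one (x : ℝ≥0∞) : negExp x ≤ 1 := by
  simpa using antitone_negExp (zero_le (a := x))

lemma negExp_add (x y : ℝ≥0∞) : negExp (x + y) = negExp x * negExp y := by
  rw [negExp, EReal.coe_ennreal_add, EReal.neg_add, sub_eq_add_neg, EReal.exp_add]
  · rfl
  · left; exact EReal.coe_ennreal_ne_bot x
  · right; exact EReal.coe_ennreal_ne_bot y

lemma negExp_sum {ι : Type*} (s : Finset ι) (f : ι → ℝ≥0∞) :
    negExp (∑ i ∈ s, f i) = ∏ i ∈ s, negExp (f i) := by
  classical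
  induction s using Finset.induction_on with
  | empty => simp
  | insert a s ha ih => rw [Finset.sum_insert ha, Finset.prod_insert ha, negExp_add, ih]

lemma negExp_of_ne_top {x : ℝ≥0∞} (hx : x ≠ ∞) :
    negExp x = ENNReal.ofReal (Real.exp (-x.toReal)) := by
  lift x to ℝ≥0 using hx
  have : (((x : ℝ≥0∞) : EReal)) = ((x : ℝ) : EReal) := rfl
  rw [negExp, this, ← EReal.coe_neg, EReal.exp_coe]
  rfl

lemma negExp_ofReal {x : ℝ} (hx : 0 ≤ x) :
    negExp (ENNReal.ofReal x) = ENNReal.ofReal (Real.exp (-x)) := by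
  rw [negExp_of_ne_top ENNReal.ofReal_ne_top, ENNReal.toReal_ofReal hx]

lemma negExp_natCast_mul (k : ℕ) (x : ℝ≥0∞) : negExp (k * x) = negExp x ^ k := by
  induction k with
  | zero => simp
  | succ k ih => rw [Nat.cast_succ, add_mul, one_mul, negExp_add, ih, pow_succ]

/-! ### Poisson counts and the Laplace functional -/

/-- The probability generating function of the Poisson distribution. -/
lemma lintegral_pow_poissonMeasure (r : ℝ≥0) {q : ℝ≥0∞} (hq : q ≤ 1) :
    ∫⁻ k, q ^ k ∂(poissonMeasure r) = negExp (r * (1 - q)) := by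
  have hq' : q ≠ ∞ := (hq.trans_lt ENNReal.one_lt_top).ne
  lift q to ℝ≥0 using hq'
  have hq1 : (q : ℝ) ≤ 1 := by exact_mod_cast hq
  have key : HasSum (fun k : ℕ => (q : ℝ) ^ k * (Real.exp (-r) * r ^ k / k.factorial))
      (Real.exp (-(r * (1 - q)))) := by
    have h := (NormedSpace.expSeries_div_hasSum_exp (𝔸 := ℝ) ((r : ℝ) * q)).mul_left
      (Real.exp (-r))
    rw [← Real.exp_eq_exp_ℝ, ← Real.exp_add] at h
    have h1 : Real.exp (-(r * (1 - q))) = Real.exp (-r + r * q) := by congr 1; ring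
    have h2 : (fun k : ℕ => (q : ℝ) ^ k * (Real.exp (-r) * r ^ k / k.factorial))
        = fun k : ℕ => Real.exp (-r) * (((r : ℝ) * q) ^ k / k.factorial) := by
      funext k
      rw [mul_pow]; ring
    rw [h1, h2]
    exact h
  have hval : negExp (r * (1 - (q : ℝ≥0∞))) = ENNReal.ofReal (Real.exp (-(r * (1 - q)))) := by
    rw [negExp_of_ne_top (by finiteness), ENNReal.toReal_mul,
      ENNReal.toReal_sub_of_le (by exact_mod_cast hq) ENNReal.one_ne_top]
    simp
  rw [hval, lintegral_countable', ← key.tsum_eq, ENNReal.ofReal_tsum_of_nonneg _ key.summable]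
  · congr 1
    funext k
    rw [poissonMeasure_singleton, ENNReal.ofReal_mul (by positivity), ENNReal.ofReal_pow (by simp)]
    simp
  · intro k
    positivity

lemma lintegral_countingMeasure {Ω : Type*} {Z : ℕ → Ω → Plane} {f : Plane → ℝ≥0∞} (hf : Measurable f) (ω : Ω) :
    ∫⁻ x, f x ∂(countingMeasure Z ω) = ∑' i, f (Z i ω) := by
  rw [countingMeasure, lintegral_sum_measure]
  simp_rw [lintegral_dirac' _ hf]

section PoissonLaplace

variable {Ω : Type*} [MeasurableSpace Ω] {P : Measure Ω} {Z : ℕ → Ω → Plane} {Λ : ℝ}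

lemma IsPoissonPointProcess.measurable_lintegral (hZ : IsPoissonPointProcess P Z Λ)
    {f : Plane → ℝ≥0∞} (hf : Measurable f) :
    Measurable fun ω => ∫⁻ x, f x ∂(countingMeasure Z ω) := by
  simp_rw [lintegral_countingMeasure hf]
  exact Measurable.tsum fun i => hf.comp (hZ.measurable i)

lemma IsPoissonPointProcess.measurable_count (hZ : IsPoissonPointProcess P Z Λ)
    {A : Set Plane} (hA : MeasurableSet A) : Measurable fun ω => countingMeasure Z ω A := by
  have := hZ.measurable_lintegral (f := A.indicator 1) (measurable_one.indicator hA)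
  simpa [lintegral_indicator_one hA] using this

/-- This is the Poisson generating function at q = exp(-y); y = ∞ is allowed. -/
lemma IsPoissonPointProcess.laplace_count (hZ : IsPoissonPointProcess P Z Λ)
    {A : Set Plane} (hA : MeasurableSet A) (hA' : volume A ≠ ∞) (y : ℝ≥0∞) :
    ∫⁻ ω, negExp (y * countingMeasure Z ω A) ∂P
      = negExp (ENNReal.ofReal Λ * ((1 - negExp y) * volume A)) := by
  have hm : Measurable fun t : ℝ≥0∞ => negExp (y * t) :=
    measurable_negExp.comp (measurable_const_mul y)
  rw [(hZ.count_law A hA hA').lintegral_comp hm.aemeasurable,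
    lintegral_map hm (measurable_of_countable _)]
  simp_rw [mul_comm y, negExp_natCast_mul]
  rw [lintegral_pow_poissonMeasure _ (negExp_le_one y), ENNReal.coe_toNNReal (by finiteness)]
  congr 1
  ring

/-- The level sets of `g` are disjoint, so their counts are independent and the expectation factors
into the one-set case. The value 0 is exempt from `hg`: its level set has infinite area in the
application and contributes nothing to either side. -/
lemma IsPoissonPointProcess.laplace_simpleFunc [IsProbabilityMeasure P]
    (hZ : IsPoissonPointProcess P Z Λ) (g : SimpleFunc Plane ℝ≥0∞)
    (hg : ∀ y, y ≠ 0 → volume (g ⁻¹' {y}) ≠ ∞) :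
    ∫⁻ ω, negExp (∫⁻ x, g x ∂(countingMeasure Z ω)) ∂P
      = negExp (ENNReal.ofReal Λ * ∫⁻ x, (1 - negExp (g x))) := by
  classical
  set s : Finset ℝ≥0∞ := g.range.filter (· ≠ 0) with hs
  have hL : ∀ ω, ∫⁻ x, g x ∂(countingMeasure Z ω)
      = ∑ y ∈ s, y * countingMeasure Z ω (g ⁻¹' {y}) := by
    intro ω
    rw [SimpleFunc.lintegral_eq_lintegral, SimpleFunc.lintegral, hs, Finset.sum_filter]
    refine Finset.sum_congr rfl fun y _ => ?_
    by_cases hy : y = 0 <;> simp [hy]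
  have hR : ∫⁻ x, (1 - negExp (g x)) = ∑ y ∈ s, (1 - negExp y) * volume (g ⁻¹' {y}) := by
    have h1 := SimpleFunc.map_lintegral (μ := volume) (fun y => 1 - negExp y) g
    have h2 : ∫⁻ x, (1 - negExp (g x)) = ∫⁻ x, (g.map fun y => 1 - negExp y) x := rfl
    rw [h2, SimpleFunc.lintegral_eq_lintegral, h1, hs, Finset.sum_filter]
    refine Finset.sum_congr rfl fun y _ => ?_
    by_cases hy : y = 0 <;> simp [hy]
  have hne : ∀ y : s, (y : ℝ≥0∞) ≠ 0 := fun y => (Finset.mem_filter.1 y.2).2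
  have hind : iIndepFun (fun (y : s) ω => countingMeasure Z ω (g ⁻¹' {(y : ℝ≥0∞)})) P := by
    -- `count_indep` speaks of families indexed by `Fin n`, so the nonzero values are enumerated and
    -- independence is pulled back along `e`.
    have e := s.equivFin
    have h := hZ.count_indep s.card (fun j => g ⁻¹' {((e.symm j : s) : ℝ≥0∞)})
      (fun j => g.measurableSet_fiber _) (fun j => hg _ (hne _)) (by
        intro j k hjk
        refine Disjoint.preimage _ (disjoint_singleton.2 fun h => hjk ?_)
        exact e.symm.injective (Subtype.ext h))
    have h' := h.precomp (g := e) e.injective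
    simpa using h'
  have hm : ∀ y : ℝ≥0∞, Measurable fun t : ℝ≥0∞ => negExp (y * t) := fun y =>
    measurable_negExp.comp (measurable_const_mul y)
  have hind' := hind.comp (fun (y : s) t => negExp (y * t)) fun y => hm y
  simp_rw [hL, hR, negExp_sum, ← Finset.prod_coe_sort s, Finset.mul_sum, negExp_sum]
  rw [← Finset.prod_coe_sort s]
  have := lintegral_prod_eq_prod_lintegral_of_indepFun Finset.univ _ hind'
    fun y => (hm y).comp (hZ.measurable_count (g.measurableSet_fiber _))
  simp only [Function.comp_def] at this
  rw [this]
  exact Finset.prod_congr rfl fun y _ =>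
    hZ.laplace_count (g.measurableSet_fiber _) (hg _ (hne y)) _

/-- The Laplace functional of a Poisson point process. -/
theorem IsPoissonPointProcess.laplace_functional [IsProbabilityMeasure P]
    (hZ : IsPoissonPointProcess P Z Λ) {f : Plane → ℝ≥0∞} (hf : Measurable f) :
    ∫⁻ ω, negExp (∑' i, f (Z i ω)) ∂P
      = negExp (ENNReal.ofReal Λ * ∫⁻ x, (1 - negExp (f x))) := by
  simp_rw [← lintegral_countingMeasure hf]
  -- Cutting the approximations off outside growing balls gives their nonzero level sets finite area
  -- and keeps them monotone in `n`.
  let g : ℕ → SimpleFunc Plane ℝ≥0∞ := fun n =>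
    (SimpleFunc.eapprox f n).restrict (Metric.ball 0 n)
  have hgapp : ∀ n x, g n x = (Metric.ball (0 : Plane) n).indicator (SimpleFunc.eapprox f n) x :=
    fun n x => SimpleFunc.restrict_apply _ Metric.isOpen_ball.measurableSet x
  have hmono : ∀ x, Monotone fun n => g n x := by
    intro x m n hmn
    simp only [hgapp]
    refine (indicator_le_indicator_of_subset (Metric.ball_subset_ball (by exact_mod_cast hmn))
      (fun _ => zero_le) x).trans (indicator_le_indicator ?_)
    exact SimpleFunc.monotone_eapprox f hmn x
  have hlim : ∀ x, Tendsto (fun n => g n x) atTop (𝓝 (f x)) := by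
    intro x
    refine (SimpleFunc.tendsto_eapprox hf x).congr' ?_
    obtain ⟨N, hN⟩ := exists_nat_gt ‖x‖
    filter_upwards [eventually_ge_atTop N] with n hn
    rw [hgapp, indicator_of_mem]
    simpa using hN.trans_le (by exact_mod_cast hn)
  have hstep : ∀ n, ∫⁻ ω, negExp (∫⁻ x, g n x ∂(countingMeasure Z ω)) ∂P
      = negExp (ENNReal.ofReal Λ * ∫⁻ x, (1 - negExp (g n x))) := by
    intro n
    refine hZ.laplace_simpleFunc (g n) fun y hy => ?_
    refine ((measure_mono ?_).trans_lt (measure_ball_lt_top (x := (0 : Plane)) (r := n))).ne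
    intro x hx
    by_contra hxn
    have : g n x = 0 := by rw [hgapp, indicator_of_notMem hxn]
    exact hy (by rw [← this]; exact (mem_singleton_iff.1 hx).symm)
  have hleft : Tendsto (fun n => ∫⁻ ω, negExp (∫⁻ x, g n x ∂(countingMeasure Z ω)) ∂P) atTop
      (𝓝 (∫⁻ ω, negExp (∫⁻ x, f x ∂(countingMeasure Z ω)) ∂P)) := by
    refine tendsto_lintegral_of_dominated_convergence (fun _ => 1)
      (fun n => measurable_negExp.comp (hZ.measurable_lintegral (g n).measurable))
      (fun n => Eventually.of_forall fun ω => negExp_le_one _) (by simp)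
      (Eventually.of_forall fun ω => (continuous_negExp.tendsto _).comp ?_)
    exact lintegral_tendsto_of_tendsto_of_monotone (fun n => (g n).measurable.aemeasurable)
      (Eventually.of_forall hmono) (Eventually.of_forall hlim)
  have hright : Tendsto (fun n => ∫⁻ x, (1 - negExp (g n x))) atTop
      (𝓝 (∫⁻ x, (1 - negExp (f x)))) := by
    refine lintegral_tendsto_of_tendsto_of_monotone
      (fun n => (measurable_const.sub (measurable_negExp.comp (g n).measurable)).aemeasurable)
      (Eventually.of_forall fun x m n hmn => tsub_le_tsub_left (antitone_negExp (hmono x hmn)) 1)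
      (Eventually.of_forall fun x => ?_)
    exact ENNReal.Tendsto.sub tendsto_const_nhds ((continuous_negExp.tendsto _).comp (hlim x))
      (Or.inl ENNReal.one_ne_top)
  refine tendsto_nhds_unique hleft ?_
  simp_rw [hstep]
  exact (continuous_negExp.tendsto _).comp
    (ENNReal.Tendsto.const_mul hright (Or.inr ENNReal.ofReal_ne_top))

end PoissonLaplace

/-! ### Sine and cosine integrals as Laplace transforms -/

/-- The auxiliary function `f` of the sine and cosine integrals. -/
noncomputable def auxSin (T : ℝ) : ℝ := ∫ x in Ioi (0 : ℝ), Real.exp (-T * x) * (1 + x ^ 2)⁻¹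

/-- The auxiliary function `g` of the sine and cosine integrals. -/
noncomputable def auxCos (T : ℝ) : ℝ :=
  ∫ x in Ioi (0 : ℝ), Real.exp (-T * x) * (x * (1 + x ^ 2)⁻¹)

lemma integrableOn_exp_neg_mul_of_bounded {T : ℝ} (hT : 0 < T) {k : ℝ → ℝ} (hk : Continuous k)
    {C : ℝ} (hC : ∀ x, |k x| ≤ C) :
    IntegrableOn (fun x => Real.exp (-T * x) * k x) (Ioi 0) :=
  (integrableOn_exp_mul_Ioi (neg_lt_zero.2 hT) 0).mul_bdd hk.aestronglyMeasurable
    (Eventually.of_forall hC)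

lemma abs_integral_exp_neg_mul_le {T : ℝ} (hT : 0 < T) {k : ℝ → ℝ}
    {C : ℝ} (hC : ∀ x, |k x| ≤ C) :
    |∫ x in Ioi (0 : ℝ), Real.exp (-T * x) * k x| ≤ C / T := by
  have h := norm_integral_le_of_norm_le (μ := volume.restrict (Ioi 0))
    (f := fun x => Real.exp (-T * x) * k x)
    ((integrableOn_exp_mul_Ioi (neg_lt_zero.2 hT) 0).mul_const C)
    (Eventually.of_forall fun x => by
      rw [norm_mul, Real.norm_eq_abs, Real.norm_eq_abs, Real.abs_exp]
      exact mul_le_mul_of_nonneg_left (hC x) (Real.exp_pos _).le)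
  rw [integral_mul_const, integral_exp_mul_Ioi (neg_lt_zero.2 hT)] at h
  refine h.trans_eq ?_
  simp
  ring

lemma abs_add_mul_div_le {a b : ℝ} (ha : |a| ≤ 1) (hb : |b| ≤ 1) (x : ℝ) :
    |(a + x * b) * (1 + x ^ 2)⁻¹| ≤ 2 := by
  rw [abs_mul, abs_inv, abs_of_pos (show 0 < 1 + x ^ 2 by positivity), ← div_eq_mul_inv,
    div_le_iff₀ (by positivity)]
  have h1 : |a + x * b| ≤ 1 + |x| := by
    refine (abs_add_le _ _).trans (add_le_add ha ?_)
    rw [abs_mul]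
    exact mul_le_of_le_one_right (abs_nonneg _) hb
  nlinarith [sq_abs x, sq_nonneg (|x| - 1)]

lemma continuous_add_mul_div (a b : ℝ) : Continuous fun x : ℝ => (a + x * b) * (1 + x ^ 2)⁻¹ :=
  (by fun_prop : Continuous fun x : ℝ => a + x * b).mul
    ((by fun_prop : Continuous fun x : ℝ => 1 + x ^ 2).inv₀ fun x => by positivity)

/-- Insert 1 / (t + T) = ∫₀^∞ exp(-(t + T) x) dx and apply Fubini. With `B` finite, exp(-T x) is an
integrable majorant; over t in (0, ∞) absolute convergence could fail, which is why the limit in `B`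
is taken later. -/
lemma integral_div_add_eq {T : ℝ} (hT : 0 < T) {φ : ℝ → ℝ} (hφ : Continuous φ)
    (hφ1 : ∀ t, |φ t| ≤ 1) {B : ℝ} (hB : 0 ≤ B) :
    ∫ t in (0 : ℝ)..B, φ t / (t + T)
      = ∫ x in Ioi (0 : ℝ), Real.exp (-T * x) * ∫ t in (0 : ℝ)..B, φ t * Real.exp (-x * t) := by
  have h1 : ∫ t in (0 : ℝ)..B, φ t / (t + T)
      = ∫ t in (0 : ℝ)..B, ∫ x in Ioi (0 : ℝ), Real.exp (-T * x) * (φ t * Real.exp (-x * t)) := by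
    refine intervalIntegral.integral_congr fun t ht => ?_
    rw [uIcc_of_le hB] at ht
    have hs : -(t + T) < 0 := by linarith [ht.1]
    have := integral_exp_mul_Ioi hs 0
    have h2 : ∀ x, Real.exp (-T * x) * (φ t * Real.exp (-x * t))
        = φ t * Real.exp (-(t + T) * x) := by
      intro x
      rw [mul_left_comm, ← Real.exp_add]
      congr 2; ring
    simp only [h2]
    rw [integral_const_mul, this]
    simp [div_eq_mul_inv, ← inv_neg]
  rw [h1, intervalIntegral_integral_swap]
  · simp_rw [intervalIntegral.integral_const_mul]
  · have hmaj : Integrable (fun z : ℝ × ℝ => (1 : ℝ) * Real.exp (-T * z.2))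
        ((volume.restrict (uIoc 0 B)).prod (volume.restrict (Ioi 0))) := by
      refine Integrable.mul_prod (f := fun _ : ℝ => (1 : ℝ)) ?_
        (integrableOn_exp_mul_Ioi (neg_lt_zero.2 hT) 0)
      rw [uIoc_of_le hB]
      exact integrableOn_const (by simp)
    refine hmaj.mono' ?_ ?_
    · refine Continuous.aestronglyMeasurable ?_
      simp only [Function.uncurry_def]
      fun_prop
    · rw [Measure.prod_restrict]
      refine (ae_restrict_mem (measurableSet_uIoc.prod measurableSet_Ioi)).mono ?_
      rintro ⟨t, x⟩ ⟨ht, hx⟩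
      rw [uIoc_of_le hB] at ht
      simp only [Function.uncurry_apply_pair, Real.norm_eq_abs, abs_mul, Real.abs_exp, one_mul]
      refine mul_le_of_le_one_right (Real.exp_pos _).le (mul_le_one₀ (hφ1 t) (Real.exp_pos _).le ?_)
      rw [Real.exp_le_one_iff]
      have : 0 < x * t := mul_pos hx ht.1
      linarith

lemma integral_cos_mul_exp (x B : ℝ) :
    ∫ t in (0 : ℝ)..B, Real.cos t * Real.exp (-x * t)
      = x * (1 + x ^ 2)⁻¹
        + Real.exp (-B * x) * ((Real.sin B + x * (-Real.cos B)) * (1 + x ^ 2)⁻¹) := by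
  have hx : (1 + x ^ 2) ≠ 0 := by positivity
  have hd : ∀ t ∈ uIcc 0 B, HasDerivAt
      (fun t => Real.exp (-x * t) * (Real.sin t - x * Real.cos t) * (1 + x ^ 2)⁻¹)
      (Real.cos t * Real.exp (-x * t)) t := by
    intro t _
    have h1 : HasDerivAt (fun t => Real.exp (-x * t)) (Real.exp (-x * t) * (-x)) t := by
      simpa using ((hasDerivAt_id t).const_mul (-x)).exp
    have h2 := (Real.hasDerivAt_sin t).sub ((Real.hasDerivAt_cos t).const_mul x)
    refine ((h1.mul h2).mul_const _).congr_deriv ?_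
    simp only [Pi.sub_apply]
    field_simp
    ring
  rw [intervalIntegral.integral_eq_sub_of_hasDerivAt hd
    (Continuous.intervalIntegrable (by fun_prop) _ _)]
  simp only [mul_zero, Real.exp_zero, Real.sin_zero, Real.cos_zero]
  rw [show -x * B = -B * x by ring]
  ring

lemma integral_sin_mul_exp (x B : ℝ) :
    ∫ t in (0 : ℝ)..B, Real.sin t * Real.exp (-x * t)
      = (1 + x ^ 2)⁻¹
        + Real.exp (-B * x) * ((-Real.cos B + x * (-Real.sin B)) * (1 + x ^ 2)⁻¹) := by
  have hx : (1 + x ^ 2) ≠ 0 := by positivity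
  have hd : ∀ t ∈ uIcc 0 B, HasDerivAt
      (fun t => Real.exp (-x * t) * (-Real.cos t - x * Real.sin t) * (1 + x ^ 2)⁻¹)
      (Real.sin t * Real.exp (-x * t)) t := by
    intro t _
    have h1 : HasDerivAt (fun t => Real.exp (-x * t)) (Real.exp (-x * t) * (-x)) t := by
      simpa using ((hasDerivAt_id t).const_mul (-x)).exp
    have h2 := (Real.hasDerivAt_cos t).neg.sub ((Real.hasDerivAt_sin t).const_mul x)
    refine ((h1.mul h2).mul_const _).congr_deriv ?_
    simp only [Pi.sub_apply, Pi.neg_apply]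
    field_simp
    ring
  rw [intervalIntegral.integral_eq_sub_of_hasDerivAt hd
    (Continuous.intervalIntegrable (by fun_prop) _ _)]
  simp only [mul_zero, Real.exp_zero, Real.sin_zero, Real.cos_zero]
  rw [show -x * B = -B * x by ring]
  ring

/-- If the partial Laplace integrals of `φ` are `k x` up to an exponentially small error, then
`∫₀^∞ φ t / (t + T) dt` converges to the Laplace transform of `k`. -/
lemma tendsto_integral_div_add {T : ℝ} (hT : 0 < T) {φ k : ℝ → ℝ} (hφ : Continuous φ)
    (hφ1 : ∀ t, |φ t| ≤ 1) (hk : IntegrableOn (fun x => Real.exp (-T * x) * k x) (Ioi 0))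
    {a b : ℝ → ℝ} (ha : ∀ B, |a B| ≤ 1) (hb : ∀ B, |b B| ≤ 1)
    (h : ∀ x B, ∫ t in (0 : ℝ)..B, φ t * Real.exp (-x * t)
      = k x + Real.exp (-B * x) * ((a B + x * b B) * (1 + x ^ 2)⁻¹)) :
    Tendsto (fun B => ∫ t in (0 : ℝ)..B, φ t / (t + T)) atTop
      (𝓝 (∫ x in Ioi (0 : ℝ), Real.exp (-T * x) * k x)) := by
  rw [tendsto_iff_norm_sub_tendsto_zero]
  have hlim : Tendsto (fun B : ℝ => 2 / (T + B)) atTop (𝓝 0) :=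
    tendsto_const_nhds.div_atTop (tendsto_atTop_add_const_left _ _ tendsto_id)
  refine squeeze_zero' (Eventually.of_forall fun _ => norm_nonneg _) ?_ hlim
  filter_upwards [eventually_ge_atTop 0] with B hB
  have hTB : 0 < T + B := by linarith
  have hi := integrableOn_exp_neg_mul_of_bounded hTB (continuous_add_mul_div (a B) (b B))
    (abs_add_mul_div_le (ha B) (hb B))
  -- The error term is the Laplace transform at T + B of a function bounded by 2, hence at most 2 /
  -- (T + B).
  have : ∫ t in (0 : ℝ)..B, φ t / (t + T) = (∫ x in Ioi (0 : ℝ), Real.exp (-T * x) * k x)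
      + ∫ x in Ioi (0 : ℝ), Real.exp (-(T + B) * x) * ((a B + x * b B) * (1 + x ^ 2)⁻¹) := by
    rw [integral_div_add_eq hT hφ hφ1 hB, ← integral_add hk hi]
    congr 1
    funext x
    rw [h, mul_add, ← mul_assoc, ← Real.exp_add]
    congr 3; ring_nf
  rw [this, add_sub_cancel_left, Real.norm_eq_abs]
  exact abs_integral_exp_neg_mul_le hTB (abs_add_mul_div_le (ha B) (hb B))

lemma integrableOn_auxCos {T : ℝ} (hT : 0 < T) :
    IntegrableOn (fun x => Real.exp (-T * x) * (x * (1 + x ^ 2)⁻¹)) (Ioi 0) := by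
  simpa using integrableOn_exp_neg_mul_of_bounded hT (continuous_add_mul_div 0 1)
    (abs_add_mul_div_le (by simp) (by simp))

lemma integrableOn_auxSin {T : ℝ} (hT : 0 < T) :
    IntegrableOn (fun x => Real.exp (-T * x) * (1 + x ^ 2)⁻¹) (Ioi 0) := by
  simpa using integrableOn_exp_neg_mul_of_bounded hT (continuous_add_mul_div 1 0)
    (abs_add_mul_div_le (by simp) (by simp))

lemma tendsto_integral_cos_div_add {T : ℝ} (hT : 0 < T) :
    Tendsto (fun B => ∫ t in (0 : ℝ)..B, Real.cos t / (t + T)) atTop (𝓝 (auxCos T)) :=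
  tendsto_integral_div_add hT Real.continuous_cos Real.abs_cos_le_one (integrableOn_auxCos hT)
    (a := fun B => Real.sin B) (b := fun B => -Real.cos B) Real.abs_sin_le_one
    (fun B => by simpa using Real.abs_cos_le_one B) integral_cos_mul_exp

lemma tendsto_integral_sin_div_add {T : ℝ} (hT : 0 < T) :
    Tendsto (fun B => ∫ t in (0 : ℝ)..B, Real.sin t / (t + T)) atTop (𝓝 (auxSin T)) :=
  tendsto_integral_div_add hT Real.continuous_sin Real.abs_sin_le_one (integrableOn_auxSin hT)
    (a := fun B => -Real.cos B) (b := fun B => -Real.sin B)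
    (fun B => by simpa using Real.abs_cos_le_one B)
    (fun B => by simpa using Real.abs_sin_le_one B) integral_sin_mul_exp

/-- Translation by T moves the lower limit to 0; the addition formulas supply `u` and `v` for ψ =
cos and ψ = sin. -/
lemma tendsto_integral_div_of_shift {T u v : ℝ} (hT : 0 < T) {ψ : ℝ → ℝ}
    (hψ : ∀ t, ψ (t + T) = u * Real.cos t + v * Real.sin t) :
    Tendsto (fun b => ∫ t in T..b, ψ t / t) atTop (𝓝 (u * auxCos T + v * auxSin T)) := by
  have hlim := ((tendsto_integral_cos_div_add hT).const_mul u).add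
    ((tendsto_integral_sin_div_add hT).const_mul v)
  have hshift : Tendsto (fun b : ℝ => b - T) atTop atTop :=
    tendsto_atTop_add_const_right _ _ tendsto_id
  refine (hlim.comp hshift).congr' ?_
  filter_upwards [eventually_ge_atTop T] with b hb
  have hint : ∀ φ : ℝ → ℝ, Continuous φ →
      IntervalIntegrable (fun t => φ t / (t + T)) volume 0 (b - T) := by
    intro φ hφ
    refine ContinuousOn.intervalIntegrable (hφ.continuousOn.div (by fun_prop) fun t ht => ?_)
    rw [uIcc_of_le (by linarith)] at ht
    linarith [ht.1]
  have h := intervalIntegral.integral_comp_add_right (a := 0) (b := b - T)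
    (fun t => ψ t / t) T
  simp only [zero_add, sub_add_cancel] at h
  simp only [Function.comp_apply]
  rw [← h, ← intervalIntegral.integral_const_mul, ← intervalIntegral.integral_const_mul,
    ← intervalIntegral.integral_add ((hint _ Real.continuous_cos).const_mul u)
      ((hint _ Real.continuous_sin).const_mul v)]
  congr 1
  funext t
  rw [hψ]; ring

lemma tendsto_integral_cos_div {T : ℝ} (hT : 0 < T) :
    Tendsto (fun b => ∫ t in T..b, Real.cos t / t) atTop
      (𝓝 (Real.cos T * auxCos T + -Real.sin T * auxSin T)) :=
  tendsto_integral_div_of_shift hT fun t => by rw [Real.cos_add]; ring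

lemma tendsto_integral_sin_div {T : ℝ} (hT : 0 < T) :
    Tendsto (fun b => ∫ t in T..b, Real.sin t / t) atTop
      (𝓝 (Real.sin T * auxCos T + Real.cos T * auxSin T)) :=
  tendsto_integral_div_of_shift hT fun t => by rw [Real.sin_add]; ring

lemma ci_eq {T : ℝ} (hT : 0 < T) :
    ci T = -(Real.cos T * auxCos T + -Real.sin T * auxSin T) := by
  rw [ci, (tendsto_integral_cos_div hT).limUnder_eq]

lemma intervalIntegrable_sin_div (a b : ℝ) :
    IntervalIntegrable (fun t => Real.sin t / t) volume a b := by
  refine (Real.continuous_sinc.intervalIntegrable a b).congr_ae (ae_restrict_of_ae ?_)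
  filter_upwards [Measure.ae_ne volume (0 : ℝ)] with t ht
  exact Real.sinc_of_ne_zero ht

lemma continuous_Si : Continuous Si :=
  intervalIntegral.continuous_primitive intervalIntegrable_sin_div 0

lemma tendsto_Si_atTop {T : ℝ} (hT : 0 < T) :
    Tendsto Si atTop (𝓝 (Si T + (Real.sin T * auxCos T + Real.cos T * auxSin T))) := by
  refine ((tendsto_integral_sin_div hT).const_add (Si T)).congr fun b => ?_
  exact intervalIntegral.integral_add_adjacent_intervals (intervalIntegrable_sin_div _ _)
    (intervalIntegrable_sin_div _ _)

lemma tendsto_auxSin_zero : Tendsto auxSin (𝓝[>] 0) (𝓝 (Real.pi / 2)) := by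
  have h : ∫ x in Ioi (0 : ℝ), (1 + x ^ 2)⁻¹ = Real.pi / 2 := by simp
  rw [← h]
  change Tendsto (fun T => ∫ x in Ioi (0 : ℝ), Real.exp (-T * x) * (1 + x ^ 2)⁻¹) _ _
  refine tendsto_integral_filter_of_dominated_convergence (fun x => (1 + x ^ 2)⁻¹) ?_ ?_
    integrable_inv_one_add_sq.integrableOn ?_
  · filter_upwards [self_mem_nhdsWithin] with T hT
    exact (integrableOn_auxSin hT).aestronglyMeasurable
  · filter_upwards [self_mem_nhdsWithin] with T hT
    filter_upwards [ae_restrict_mem measurableSet_Ioi] with x hx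
    rw [Real.norm_eq_abs, abs_of_nonneg (by positivity)]
    refine mul_le_of_le_one_left (by positivity) ?_
    rw [Real.exp_le_one_iff]
    linarith [mul_pos (mem_Ioi.1 hT) (mem_Ioi.1 hx)]
  · refine Eventually.of_forall fun x => ?_
    have : Continuous fun T : ℝ => Real.exp (-T * x) * (1 + x ^ 2)⁻¹ := by fun_prop
    simpa using (this.tendsto 0).mono_left nhdsWithin_le_nhds

/-- `auxCos` itself is unbounded near 0, but T x exp(-T x) ≤ 1 lets (1 + x²)⁻¹ dominate T times its
integrand. -/
lemma tendsto_mul_auxCos_zero : Tendsto (fun T => T * auxCos T) (𝓝[>] 0) (𝓝 0) := by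
  simp_rw [auxCos, ← integral_const_mul]
  rw [show 𝓝 (0 : ℝ) = 𝓝 (∫ x in Ioi (0 : ℝ), (0 : ℝ)) by simp]
  refine tendsto_integral_filter_of_dominated_convergence (fun x => (1 + x ^ 2)⁻¹) ?_ ?_
    integrable_inv_one_add_sq.integrableOn ?_
  · filter_upwards [self_mem_nhdsWithin] with T hT
    exact ((integrableOn_auxCos hT).const_mul T).aestronglyMeasurable
  · filter_upwards [self_mem_nhdsWithin] with T hT
    filter_upwards [ae_restrict_mem measurableSet_Ioi] with x hx
    have hTx := mul_pos (mem_Ioi.1 hT) (mem_Ioi.1 hx)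
    have hT' := mem_Ioi.1 hT
    have hx' := mem_Ioi.1 hx
    rw [Real.norm_eq_abs, abs_of_nonneg (by positivity), ← mul_assoc, ← mul_assoc]
    refine mul_le_of_le_one_left (by positivity) ?_
    rw [neg_mul, Real.exp_neg, mul_right_comm, ← div_eq_mul_inv, div_le_one (Real.exp_pos _)]
    linarith [Real.add_one_le_exp (T * x)]
  · refine Eventually.of_forall fun x => ?_
    have : Continuous fun T : ℝ => T * (Real.exp (-T * x) * (x * (1 + x ^ 2)⁻¹)) := by fun_prop
    simpa using (this.tendsto 0).mono_left nhdsWithin_le_nhds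

/-- The Dirichlet integral in the form `π / 2 - Si T = ∫_T^∞ sin t / t dt`. -/
lemma Si_eq {T : ℝ} (hT : 0 < T) :
    Si T = Real.pi / 2 - (Real.sin T * auxCos T + Real.cos T * auxSin T) := by
  have hsin : Tendsto (fun S => Real.sin S * auxCos S) (𝓝[>] 0) (𝓝 0) := by
    refine squeeze_zero_norm' ?_ tendsto_mul_auxCos_zero
    filter_upwards [self_mem_nhdsWithin] with S hS
    have hpos : 0 ≤ auxCos S := setIntegral_nonneg measurableSet_Ioi fun x hx => by
      have := mem_Ioi.1 hx
      positivity
    rw [norm_mul, Real.norm_eq_abs, Real.norm_eq_abs, abs_of_nonneg hpos]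
    refine mul_le_mul_of_nonneg_right ?_ hpos
    simpa [abs_of_pos (mem_Ioi.1 hS)] using Real.abs_sin_le_abs (x := S)
  have hcos : Tendsto (fun S => Real.cos S * auxSin S) (𝓝[>] 0) (𝓝 (1 * (Real.pi / 2))) := by
    refine Tendsto.mul ?_ tendsto_auxSin_zero
    simpa using (Real.continuous_cos.tendsto 0).mono_left nhdsWithin_le_nhds
  have hSi : Tendsto Si (𝓝[>] 0) (𝓝 0) := by
    simpa [Si] using (continuous_Si.tendsto 0).mono_left nhdsWithin_le_nhds
  have hlim := hSi.add (hsin.add hcos)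
  -- For every S > 0 this expression is the limit of `Si` at infinity, so it does not depend on S;
  -- letting S → 0⁺ identifies it as π / 2.
  have hconst : ∀ᶠ S in 𝓝[>] (0 : ℝ), Si S + (Real.sin S * auxCos S + Real.cos S * auxSin S)
      = Si T + (Real.sin T * auxCos T + Real.cos T * auxSin T) := by
    filter_upwards [self_mem_nhdsWithin] with S hS
    exact tendsto_nhds_unique (tendsto_Si_atTop hS) (tendsto_Si_atTop hT)
  have := tendsto_nhds_unique (hlim.congr' hconst) tendsto_const_nhds
  linarith

/-- After substitution π and the `auxSin` terms cancel, and sin² + cos² = 1 collects the rest. -/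
lemma closedForm_eq_two_mul_auxCos {T : ℝ} (hT : 0 < T) :
    (Real.pi - 2 * Si T) * Real.sin T - 2 * ci T * Real.cos T = 2 * auxCos T := by
  rw [Si_eq hT, ci_eq hT]
  linear_combination 2 * auxCos T * Real.sin_sq_add_cos_sq T

/-! ### The integral of exp(-T √τ) / (1 + τ) -/

/-- Integrand after the substitution τ = x², Jacobian included, in the form the `rpow` change of
variables expects. -/
lemma exp_sqrt_div_comp_sq {T x : ℝ} (hx : x ∈ Ioi (0 : ℝ)) :
    ((2 : ℝ) * x ^ ((2 : ℝ) - 1)) • (Real.exp (-(T * √(x ^ (2 : ℝ)))) / (1 + x ^ (2 : ℝ)))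
      = 2 * (Real.exp (-T * x) * (x * (1 + x ^ 2)⁻¹)) := by
  have h1 : x ^ ((2 : ℝ) - 1) = x := by norm_num
  rw [h1, Real.rpow_two, Real.sqrt_sq (mem_Ioi.1 hx).le, smul_eq_mul, neg_mul]
  ring

lemma integrableOn_exp_sqrt_div {T : ℝ} (hT : 0 < T) :
    IntegrableOn (fun τ : ℝ => Real.exp (-(T * √τ)) / (1 + τ)) (Ioi 0) := by
  rw [← integrableOn_Ioi_comp_rpow_iff _ (two_ne_zero (α := ℝ)), abs_of_pos two_pos]
  exact IntegrableOn.congr_fun ((integrableOn_auxCos hT).const_mul 2)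
    (fun x hx => (exp_sqrt_div_comp_sq hx).symm) measurableSet_Ioi

lemma integral_exp_sqrt_div (T : ℝ) :
    ∫ τ in Ioi (0 : ℝ), Real.exp (-(T * √τ)) / (1 + τ) = 2 * auxCos T := by
  rw [← integral_comp_rpow_Ioi_of_pos (two_pos (α := ℝ)), auxCos, ← integral_const_mul]
  exact setIntegral_congr_fun measurableSet_Ioi fun x hx => exp_sqrt_div_comp_sq hx

/-! ### Exponential laws and averaging over the fading -/

lemma lintegral_expMeasure (f : ℝ → ℝ≥0∞) (hf : Measurable f) :
    ∫⁻ x, f x ∂(expMeasure 1) = ∫⁻ x, exponentialPDF 1 x * f x := by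
  have hm : Measurable (gammaPDF 1 1) := (measurable_gammaPDFReal 1 1).ennreal_ofReal
  rw [expMeasure, gammaMeasure, lintegral_withDensity_eq_lintegral_mul _ hm hf]
  rfl

/-- The Laplace transform of the unit mean exponential distribution. -/
lemma laplace_expMeasure {a : ℝ} (ha : 0 ≤ a) :
    ∫⁻ x, negExp (ENNReal.ofReal (a * x)) ∂(expMeasure 1)
      = negExp (ENNReal.ofReal (Real.log (1 + a))) := by
  have hm : Measurable fun x => negExp (ENNReal.ofReal (a * x)) :=
    measurable_negExp.comp (measurable_const_mul a).ennreal_ofReal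
  have h1a : 0 < 1 + a := by linarith
  rw [lintegral_expMeasure _ hm, negExp_ofReal (Real.log_nonneg (by linarith)), Real.exp_neg,
    Real.exp_log h1a]
  -- Tilting the unit-rate density by exp(-a x) gives the density of rate 1 + a up to the factor 1 /
  -- (1 + a), so no integral has to be computed.
  have : ∀ x, exponentialPDF 1 x * negExp (ENNReal.ofReal (a * x))
      = ENNReal.ofReal (1 + a)⁻¹ * exponentialPDF (1 + a) x := by
    intro x
    rcases lt_or_ge x 0 with hx | hx
    · simp [exponentialPDF_of_neg hx]
    · rw [exponentialPDF_of_nonneg hx, exponentialPDF_of_nonneg hx,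
        negExp_ofReal (mul_nonneg ha hx), ← ENNReal.ofReal_mul (by positivity),
        ← ENNReal.ofReal_mul (by positivity), one_mul, inv_mul_cancel_left₀ h1a.ne',
        ← Real.exp_add]
      congr 2; ring
  simp_rw [this]
  rw [lintegral_const_mul' _ _ ENNReal.ofReal_ne_top, lintegral_exponentialPDF_eq_one h1a, mul_one]

lemma expMeasure_Ioi {t : ℝ} (ht : 0 ≤ t) :
    expMeasure 1 (Ioi t) = ENNReal.ofReal (Real.exp (-t)) := by
  have := isProbabilityMeasure_expMeasure one_pos
  have h : (expMeasure 1).real (Ioi t) = Real.exp (-t) := by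
    rw [← compl_Iic, probReal_compl_eq_one_sub measurableSet_Iic, ← cdf_eq_real,
      cdf_expMeasure_eq one_pos, if_pos ht]
    simp
  rw [← h, ofReal_measureReal]

section Fading

variable {Ω : Type*} [MeasurableSpace Ω] {P : Measure Ω} [IsProbabilityMeasure P]
  {Z : ℕ → Ω → Plane} {h : ℕ → Ω → ℝ} {h₀ : Ω → ℝ} {Λ : ℝ}

/-- By independence the positions may be frozen; the gains then contribute a product of exponential
Laplace transforms. Writing 1 / (1 + w) as exp(-log(1 + w)) prepares the use of the Laplace
functional. -/
lemma IsD2DEnvironment.lintegral_fading_finite (henv : IsD2DEnvironment P Z h h₀ Λ)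
    {w : Plane → ℝ} (hw : Measurable w) (hw0 : ∀ x, 0 ≤ w x) (n : ℕ) :
    ∫⁻ ω, negExp (∑ i ∈ Finset.range n, ENNReal.ofReal (w (Z i ω) * h i ω)) ∂P
      = ∫⁻ ω, negExp (∑ i ∈ Finset.range n, ENNReal.ofReal (Real.log (1 + w (Z i ω)))) ∂P := by
  have hH : Measurable fun ω i => h i ω := measurable_pi_lambda _ henv.measurable_h
  have hZ : Measurable fun ω i => Z i ω := measurable_pi_lambda _ henv.ppp.measurable
  have : IsProbabilityMeasure (P.map fun ω i => h i ω) :=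
    Measure.isProbabilityMeasure_map hH.aemeasurable
  have : IsProbabilityMeasure (P.map fun ω i => Z i ω) :=
    Measure.isProbabilityMeasure_map hZ.aemeasurable
  let F : (ℕ → ℝ) × (ℕ → Plane) → ℝ≥0∞ := fun q =>
    ∏ i ∈ Finset.range n, negExp (ENNReal.ofReal (w (q.2 i) * q.1 i))
  have hF : Measurable F := Finset.measurable_fun_prod _ fun i _ =>
    measurable_negExp.comp (((hw.comp ((measurable_pi_apply i).comp measurable_snd)).mul
      ((measurable_pi_apply i).comp measurable_fst)).ennreal_ofReal)
  have hlaw := (indepFun_iff_map_prod_eq_prod_map_map hH.aemeasurable hZ.aemeasurable).1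
    henv.indep_h_Z
  simp_rw [negExp_sum]
  have e1 : ∫⁻ ω, ∏ i ∈ Finset.range n, negExp (ENNReal.ofReal (w (Z i ω) * h i ω)) ∂P
      = ∫⁻ q, F q ∂(P.map fun ω => ((fun i => h i ω), (fun i => Z i ω))) :=
    (lintegral_map hF (hH.prodMk hZ)).symm
  rw [e1, hlaw, lintegral_prod_symm' _ hF]
  have e2 : ∀ z : ℕ → Plane, ∫⁻ x, F (x, z) ∂(P.map fun ω i => h i ω)
      = ∏ i ∈ Finset.range n, negExp (ENNReal.ofReal (Real.log (1 + w (z i)))) := by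
    intro z
    have hm : ∀ i, Measurable fun x : ℝ => negExp (ENNReal.ofReal (w (z i) * x)) := fun i =>
      measurable_negExp.comp (measurable_const_mul (w (z i))).ennreal_ofReal
    refine (lintegral_map (hF.comp measurable_prodMk_right) hH).trans ?_
    refine (lintegral_prod_eq_prod_lintegral_of_indepFun (Finset.range n) _
      (henv.indep_h.comp _ hm) fun i => (hm i).comp (henv.measurable_h i)).trans ?_
    refine Finset.prod_congr rfl fun i _ => ?_
    rw [← laplace_expMeasure (hw0 (z i)), ← (henv.law_h i).lintegral_comp (hm i).aemeasurable]
    rfl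
  simp_rw [e2]
  exact lintegral_map (Finset.measurable_fun_prod _ fun i _ => measurable_negExp.comp
    (((hw.comp (measurable_pi_apply i)).const_add 1).log.ennreal_ofReal)) hZ

/-- Averaging out the Rayleigh fading. -/
lemma IsD2DEnvironment.lintegral_fading (henv : IsD2DEnvironment P Z h h₀ Λ)
    {w : Plane → ℝ} (hw : Measurable w) (hw0 : ∀ x, 0 ≤ w x) :
    ∫⁻ ω, negExp (∑' i, ENNReal.ofReal (w (Z i ω) * h i ω)) ∂P
      = ∫⁻ ω, negExp (∑' i, ENNReal.ofReal (Real.log (1 + w (Z i ω)))) ∂P := by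
  -- Partial sums converge in [0, ∞] even if the series diverges, and `negExp` is continuous at ∞,
  -- so dominated convergence with bound 1 always applies.
  have key : ∀ u : ℕ → Ω → ℝ≥0∞, (∀ i, Measurable (u i)) →
      Tendsto (fun n => ∫⁻ ω, negExp (∑ i ∈ Finset.range n, u i ω) ∂P) atTop
        (𝓝 (∫⁻ ω, negExp (∑' i, u i ω) ∂P)) := by
    intro u hu
    refine tendsto_lintegral_of_dominated_convergence (fun _ => 1)
      (fun n => measurable_negExp.comp (Finset.measurable_fun_sum _ fun i _ => hu i))
      (fun n => Eventually.of_forall fun ω => negExp_le_one _) (by simp)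
      (Eventually.of_forall fun ω => (continuous_negExp.tendsto _).comp
        (ENNReal.tendsto_nat_tsum _))
  refine tendsto_nhds_unique (key _ fun i =>
    ((hw.comp (henv.ppp.measurable i)).mul (henv.measurable_h i)).ennreal_ofReal) ?_
  simp_rw [henv.lintegral_fading_finite hw hw0]
  exact key _ fun i => ((hw.comp (henv.ppp.measurable i)).const_add 1).log.ennreal_ofReal

end Fading

/-! ### The planar integral for path-loss exponent 4 -/

/-- For y > 0 the integrand is y a² / (y⁴ + a²), with antiderivative (a / 2) arctan(y² / a). Being
nonnegative with a convergent antiderivative, it is integrable. -/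
lemma integrableOn_and_integral_mul_inv_pow_four {a : ℝ} (ha : 0 < a) :
    IntegrableOn (fun y : ℝ => y * (1 - (1 + a ^ 2 * y ^ (-4 : ℝ))⁻¹)) (Ioi 0) ∧
    ∫ y in Ioi (0 : ℝ), y * (1 - (1 + a ^ 2 * y ^ (-4 : ℝ))⁻¹) = a * Real.pi / 4 := by
  have hd : ∀ x ∈ Ici (0 : ℝ), HasDerivAt (fun y => a / 2 * Real.arctan (y ^ 2 / a))
      (x * (a ^ 2 / (x ^ 4 + a ^ 2))) x := by
    intro x _
    have h1 : HasDerivAt (fun y : ℝ => y ^ 2 / a) (2 * x / a) x := by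
      simpa using (hasDerivAt_pow 2 x).div_const a
    refine (h1.arctan.const_mul (a / 2)).congr_deriv ?_
    field_simp
    ring
  have hlim : Tendsto (fun y : ℝ => a / 2 * Real.arctan (y ^ 2 / a)) atTop
      (𝓝 (a / 2 * (Real.pi / 2))) := by
    refine Tendsto.const_mul _ ((tendsto_nhds_of_tendsto_nhdsWithin
      Real.tendsto_arctan_atTop).comp ?_)
    exact (tendsto_pow_atTop two_ne_zero).atTop_div_const ha
  have hpos : ∀ x ∈ Ioi (0 : ℝ), 0 ≤ x * (a ^ 2 / (x ^ 4 + a ^ 2)) := fun x hx => by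
    have := mem_Ioi.1 hx
    positivity
  have heq : EqOn (fun x : ℝ => x * (a ^ 2 / (x ^ 4 + a ^ 2)))
      (fun y : ℝ => y * (1 - (1 + a ^ 2 * y ^ (-4 : ℝ))⁻¹)) (Ioi 0) := by
    intro x hx
    have hx' := mem_Ioi.1 hx
    have h4 : x ^ (-4 : ℝ) = (x ^ 4)⁻¹ := by
      rw [Real.rpow_neg hx'.le]
      norm_cast
    simp only [h4]
    field_simp
    ring
  refine ⟨(integrableOn_Ioi_deriv_of_nonneg' hd hpos hlim).congr_fun heq measurableSet_Ioi, ?_⟩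
  rw [← setIntegral_congr_fun measurableSet_Ioi heq,
    integral_Ioi_of_hasDerivAt_of_nonneg' hd hpos hlim]
  simp
  ring

lemma lintegral_one_sub_negExp_log {a : ℝ} (ha : 0 < a) :
    ∫⁻ x : Plane, (1 - negExp (ENNReal.ofReal (Real.log (1 + a ^ 2 * ‖x‖ ^ (-4 : ℝ)))))
      = ENNReal.ofReal (Real.pi ^ 2 / 2 * a) := by
  obtain ⟨hint, hval⟩ := integrableOn_and_integral_mul_inv_pow_four ha
  have hw : ∀ x : Plane, 0 ≤ a ^ 2 * ‖x‖ ^ (-4 : ℝ) := fun x => by positivity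
  have h1 : ∀ x : Plane, 1 - negExp (ENNReal.ofReal (Real.log (1 + a ^ 2 * ‖x‖ ^ (-4 : ℝ))))
      = ENNReal.ofReal (1 - (1 + a ^ 2 * ‖x‖ ^ (-4 : ℝ))⁻¹) := by
    intro x
    have := hw x
    rw [negExp_ofReal (Real.log_nonneg (by linarith)), Real.exp_neg,
      Real.exp_log (by linarith), ENNReal.ofReal_sub _ (by positivity), ENNReal.ofReal_one]
  have hdim : Module.finrank ℝ Plane = 2 := by simp
  have hI : Integrable fun x : Plane => 1 - (1 + a ^ 2 * ‖x‖ ^ (-4 : ℝ))⁻¹ := by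
    refine (integrable_fun_norm_addHaar (μ := (volume : Measure Plane))
      (f := fun y : ℝ => 1 - (1 + a ^ 2 * y ^ (-4 : ℝ))⁻¹)).2 ?_
    simpa [hdim] using hint
  simp_rw [h1]
  rw [← ofReal_integral_eq_lintegral_ofReal hI]
  · congr 1
    rw [integral_fun_norm_addHaar (volume : Measure Plane)
      (fun y : ℝ => 1 - (1 + a ^ 2 * y ^ (-4 : ℝ))⁻¹), hdim]
    simp only [smul_eq_mul, Nat.add_one_sub_one, pow_one, nsmul_eq_mul]
    -- The constant is the dimension 2, times the area π of the unit disc, times the radial integral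
    -- a π / 4.
    rw [hval, measureReal_def, EuclideanSpace.volume_ball_fin_two]
    simp [ENNReal.toReal_ofReal Real.pi_pos.le]
    ring
  · refine Eventually.of_forall fun x => ?_
    have := hw x
    simp only [Pi.zero_apply, sub_nonneg]
    exact inv_le_one_of_one_le₀ (by linarith)

/-! ### Law of the interference -/

/-- Exhibits I as a measurable function of gains and positions jointly, which transfers the
independence of h₀ to I. -/
lemma measurable_tsum_power (ρ α : ℝ) :
    Measurable fun q : (ℕ → ℝ) × (ℕ → Plane) =>
      ∑' i, ENNReal.ofReal (ρ * q.1 i * ‖q.2 i‖ ^ (-α)) :=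
  Measurable.tsum fun i => by fun_prop

lemma IsD2DEnvironment.measurable_interference {Ω : Type*} [MeasurableSpace Ω] {P : Measure Ω}
    {Z : ℕ → Ω → Plane} {h : ℕ → Ω → ℝ} {h₀ : Ω → ℝ} {Λ : ℝ}
    (henv : IsD2DEnvironment P Z h h₀ Λ) (ρ α : ℝ) :
    Measurable (interference ρ α Z h) :=
  (measurable_tsum_power ρ α).comp ((measurable_pi_lambda _ henv.measurable_h).prodMk
    (measurable_pi_lambda _ henv.ppp.measurable))

section Interference

variable {Ω : Type*} [MeasurableSpace Ω] {P : Measure Ω} [IsProbabilityMeasure P]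
  {Z : ℕ → Ω → Plane} {h : ℕ → Ω → ℝ} {h₀ : Ω → ℝ} {Λ ρ : ℝ}

/-- The Laplace transform of the interference for path-loss exponent `4`. -/
lemma IsD2DEnvironment.lintegral_negExp_interference (henv : IsD2DEnvironment P Z h h₀ Λ)
    (hΛ : 0 < Λ) (hρ : 0 < ρ) {s : ℝ} (hs : 0 < s) :
    ∫⁻ ω, negExp (ENNReal.ofReal s * interference ρ 4 Z h ω) ∂P
      = negExp (ENNReal.ofReal (Λ * (Real.pi ^ 2 / 2 * √(s * ρ)))) := by
  have ha : 0 < √(s * ρ) := Real.sqrt_pos.2 (by positivity)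
  have hw : Measurable fun x : Plane => √(s * ρ) ^ 2 * ‖x‖ ^ (-4 : ℝ) := by fun_prop
  have h1 : ∀ ω, ENNReal.ofReal s * interference ρ 4 Z h ω
      = ∑' i, ENNReal.ofReal (√(s * ρ) ^ 2 * ‖Z i ω‖ ^ (-4 : ℝ) * h i ω) := by
    intro ω
    rw [interference, ← ENNReal.tsum_mul_left]
    congr 1
    funext i
    rw [← ENNReal.ofReal_mul hs.le, Real.sq_sqrt (by positivity)]
    congr 1; ring
  simp_rw [h1]
  rw [henv.lintegral_fading hw fun x => by positivity,
    henv.ppp.laplace_functional (f := fun x =>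
      ENNReal.ofReal (Real.log (1 + √(s * ρ) ^ 2 * ‖x‖ ^ (-4 : ℝ))))
      ((hw.const_add 1).log.ennreal_ofReal),
    lintegral_one_sub_negExp_log ha, ← ENNReal.ofReal_mul hΛ.le]

/-- Since exp(-s I) vanishes where I = ∞, 𝔼[exp(-s I)] ≤ P(I < ∞); the left side tends to 1 as s →
0⁺. -/
lemma IsD2DEnvironment.interference_lt_top (henv : IsD2DEnvironment P Z h h₀ Λ)
    (hΛ : 0 < Λ) (hρ : 0 < ρ) : ∀ᵐ ω ∂P, interference ρ 4 Z h ω < ∞ := by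
  have hm : MeasurableSet {ω | interference ρ 4 Z h ω < ∞} :=
    henv.measurable_interference ρ 4 measurableSet_Iio
  have hlim : Tendsto (fun s : ℝ => negExp (ENNReal.ofReal (Λ * (Real.pi ^ 2 / 2 * √(s * ρ)))))
      (𝓝[>] 0) (𝓝 1) := by
    have : Continuous fun s : ℝ =>
        negExp (ENNReal.ofReal (Λ * (Real.pi ^ 2 / 2 * √(s * ρ)))) :=
      continuous_negExp.comp (ENNReal.continuous_ofReal.comp (by fun_prop))
    simpa using (this.tendsto 0).mono_left nhdsWithin_le_nhds
  have hle : (1 : ℝ≥0∞) ≤ P {ω | interference ρ 4 Z h ω < ∞} := by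
    refine le_of_tendsto hlim ?_
    filter_upwards [self_mem_nhdsWithin] with s hs
    rw [← henv.lintegral_negExp_interference hΛ hρ hs, ← lintegral_indicator_one hm]
    refine lintegral_mono fun ω => ?_
    by_cases hω : interference ρ 4 Z h ω < ∞
    · rw [indicator_of_mem (by exact hω)]
      exact negExp_le_one _
    · rw [not_lt_top_iff.1 hω, ENNReal.mul_top (by simpa using hs), negExp_top]
      exact zero_le
  exact (prob_compl_eq_zero_iff hm).2 (le_antisymm prob_le_one hle)

/-- Here P(I = 0) ≤ 𝔼[exp(-s I)] → 0 as s → ∞. This removes the event on which the ratio has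
denominator 0. -/
lemma IsD2DEnvironment.interference_ne_zero (henv : IsD2DEnvironment P Z h h₀ Λ)
    (hΛ : 0 < Λ) (hρ : 0 < ρ) : ∀ᵐ ω ∂P, interference ρ 4 Z h ω ≠ 0 := by
  have hm : MeasurableSet {ω | interference ρ 4 Z h ω = 0} :=
    henv.measurable_interference ρ 4 (measurableSet_singleton 0)
  have hlim : Tendsto (fun s : ℝ => negExp (ENNReal.ofReal (Λ * (Real.pi ^ 2 / 2 * √(s * ρ)))))
      atTop (𝓝 0) := by
    rw [← negExp_top]
    refine (continuous_negExp.tendsto _).comp (ENNReal.tendsto_ofReal_atTop.comp ?_)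
    refine Tendsto.const_mul_atTop hΛ (Tendsto.const_mul_atTop (by positivity) ?_)
    exact Real.tendsto_sqrt_atTop.comp (tendsto_id.atTop_mul_const hρ)
  have hle : P {ω | interference ρ 4 Z h ω = 0} ≤ 0 := by
    refine ge_of_tendsto hlim ?_
    filter_upwards [eventually_gt_atTop 0] with s hs
    rw [← henv.lintegral_negExp_interference hΛ hρ hs, ← lintegral_indicator_one hm]
    refine lintegral_mono fun ω => ?_
    by_cases hω : interference ρ 4 Z h ω = 0
    · rw [hω, mul_zero, negExp_zero]
      exact indicator_le_self' (fun _ _ => zero_le) ω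
    · rw [indicator_of_notMem (by exact hω)]
      exact zero_le
  rw [ae_iff]
  simpa using hle

lemma IsD2DEnvironment.lintegral_exp_interference (henv : IsD2DEnvironment P Z h h₀ Λ)
    (hΛ : 0 < Λ) (hρ : 0 < ρ) {s : ℝ} (hs : 0 < s) :
    ∫⁻ ω, ENNReal.ofReal (Real.exp (-s * (interference ρ 4 Z h ω).toReal)) ∂P
      = ENNReal.ofReal (Real.exp (-(Λ * (Real.pi ^ 2 / 2 * √(s * ρ))))) := by
  rw [← negExp_ofReal (by positivity), ← henv.lintegral_negExp_interference hΛ hρ hs]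
  refine lintegral_congr_ae ?_
  filter_upwards [henv.interference_lt_top hΛ hρ] with ω hω
  rw [negExp_of_ne_top (ENNReal.mul_ne_top ENNReal.ofReal_ne_top hω.ne), ENNReal.toReal_mul,
    ENNReal.toReal_ofReal hs.le, neg_mul]

lemma IsD2DEnvironment.laplaceInterference_eq (henv : IsD2DEnvironment P Z h h₀ Λ)
    (hΛ : 0 < Λ) (hρ : 0 < ρ) {s : ℝ} (hs : 0 < s) :
    laplaceInterference P ρ 4 Z h s = Real.exp (-(Λ * (Real.pi ^ 2 / 2 * √(s * ρ)))) := by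
  rw [laplaceInterference, integral_eq_lintegral_of_nonneg_ae
    (Eventually.of_forall fun _ => (Real.exp_pos _).le)
    (((henv.measurable_interference ρ 4).ennreal_toReal.const_mul _).exp.aestronglyMeasurable),
    henv.lintegral_exp_interference hΛ hρ hs, ENNReal.toReal_ofReal (Real.exp_pos _).le]

/-- The complementary distribution function of the ratio of desired power to interference. -/
lemma IsD2DEnvironment.measure_mul_interference_lt (henv : IsD2DEnvironment P Z h h₀ Λ)
    (hΛ : 0 < Λ) (hρ : 0 < ρ) {s : ℝ} (hs : 0 < s) :
    P {ω | s * (interference ρ 4 Z h ω).toReal < h₀ ω}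
      = ENNReal.ofReal (Real.exp (-(Λ * (Real.pi ^ 2 / 2 * √(s * ρ))))) := by
  have hJ : Measurable fun ω => (interference ρ 4 Z h ω).toReal :=
    (henv.measurable_interference ρ 4).ennreal_toReal
  have hind : IndepFun h₀ (fun ω => (interference ρ 4 Z h ω).toReal) P :=
    henv.indep_h₀.comp measurable_id (measurable_tsum_power ρ 4).ennreal_toReal
  have hlaw := (indepFun_iff_map_prod_eq_prod_map_map henv.measurable_h₀.aemeasurable
    hJ.aemeasurable).1 hind
  have : IsProbabilityMeasure (P.map fun ω => (interference ρ 4 Z h ω).toReal) :=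
    Measure.isProbabilityMeasure_map hJ.aemeasurable
  have : IsProbabilityMeasure (expMeasure 1) := isProbabilityMeasure_expMeasure one_pos
  have hS : MeasurableSet {q : ℝ × ℝ | s * q.2 < q.1} :=
    measurableSet_lt (measurable_snd.const_mul s) measurable_fst
  have e1 : P {ω | s * (interference ρ 4 Z h ω).toReal < h₀ ω}
      = P.map (fun ω => (h₀ ω, (interference ρ 4 Z h ω).toReal)) {q : ℝ × ℝ | s * q.2 < q.1} :=
    (Measure.map_apply (henv.measurable_h₀.prodMk hJ) hS).symm
  -- Integrating out h₀ first leaves the exponential tail exp(-s I), whose mean is already known.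
  rw [e1, hlaw, henv.law_h₀.map_eq, Measure.prod_apply_symm hS,
    lintegral_map (measurable_measure_prodMk_right hS) hJ,
    ← henv.lintegral_exp_interference hΛ hρ hs]
  congr 1
  funext ω
  rw [neg_mul, ← expMeasure_Ioi (mul_nonneg hs.le ENNReal.toReal_nonneg)]
  rfl

end Interference

/-! ### From the tail of the ratio to the spectral efficiency -/

lemma integral_inv_one_add {x : ℝ} (hx : 0 ≤ x) :
    ∫ t in (0 : ℝ)..x, (1 + t)⁻¹ = Real.log (1 + x) := by
  have h := intervalIntegral.integral_comp_add_left (a := 0) (b := x) (fun t : ℝ => t⁻¹) 1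
  rw [h, integral_inv_of_pos (by norm_num) (by linarith)]
  simp

/-- The exponent of the Laplace transform at `τ R⁴ / ρ` is `T √τ`. -/
lemma laplace_exponent_eq {ρ : ℝ} (hρ : 0 < ρ) (Λ R : ℝ) (τ : ℝ) :
    Λ * (Real.pi ^ 2 / 2 * √(τ * R ^ (4 : ℝ) / ρ * ρ)) = Real.pi ^ 2 / 2 * Λ * R ^ 2 * √τ := by
  have h4 : R ^ (4 : ℝ) = (R ^ 2) ^ 2 := by
    rw [← pow_mul]
    norm_cast
  rw [div_mul_cancel₀ _ hρ.ne', h4, mul_comm τ, Real.sqrt_mul (by positivity),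
    Real.sqrt_sq (by positivity)]
  ring

/-- Valid for every ω: when the real-valued interference is 0, both quotients are 0 by convention.
-/
lemma sinr_eq {Ω : Type*} {Z : ℕ → Ω → Plane} {h : ℕ → Ω → ℝ} {h₀ : Ω → ℝ} {ρ R : ℝ}
    (hρ : 0 < ρ) (hR : 0 < R) (δ : D2DMode) (ω : Ω) :
    sinr δ 0 0 ρ R 4 Z h h₀ ω
      = h₀ ω / (R ^ (4 : ℝ) / ρ * (interference ρ 4 Z h ω).toReal) := by
  have hR4 : 0 < R ^ (4 : ℝ) := Real.rpow_pos_of_pos hR 4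
  rw [sinr, Real.rpow_neg hR.le, zero_mul, mul_zero, add_zero, zero_add]
  field_simp

section SpectralEfficiency

variable {Ω : Type*} [MeasurableSpace Ω] {P : Measure Ω}
  {Z : ℕ → Ω → Plane} {h : ℕ → Ω → ℝ} {h₀ : Ω → ℝ} {Λ ρ R : ℝ}

lemma IsD2DEnvironment.sinr_nonneg (henv : IsD2DEnvironment P Z h h₀ Λ) (hρ : 0 < ρ)
    (hR : 0 < R) (δ : D2DMode) : ∀ᵐ ω ∂P, 0 ≤ sinr δ 0 0 ρ R 4 Z h h₀ ω := by
  have hR4 : 0 < R ^ (4 : ℝ) := Real.rpow_pos_of_pos hR 4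
  have hpos : ∀ᵐ ω ∂P, h₀ ω ∈ Ioi (0 : ℝ) := by
    have := isProbabilityMeasure_expMeasure one_pos
    rw [henv.law_h₀.ae_iff (p := (· ∈ Ioi (0 : ℝ))) measurableSet_Ioi.mem]
    refine (mem_ae_iff_prob_eq_one measurableSet_Ioi).2 ?_
    simp [expMeasure_Ioi le_rfl]
  filter_upwards [hpos] with ω hω
  have := mem_Ioi.1 hω
  rw [sinr_eq hρ hR]
  positivity

lemma IsD2DEnvironment.measurable_sinr (henv : IsD2DEnvironment P Z h h₀ Λ) (hρ : 0 < ρ)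
    (hR : 0 < R) (δ : D2DMode) : Measurable (sinr δ 0 0 ρ R 4 Z h h₀) := by
  simp_rw [funext fun ω => sinr_eq (Z := Z) (h := h) (h₀ := h₀) hρ hR δ ω]
  exact henv.measurable_h₀.div ((henv.measurable_interference ρ 4).ennreal_toReal.const_mul _)

variable [IsProbabilityMeasure P]

lemma IsD2DEnvironment.seIntegrand_eq (henv : IsD2DEnvironment P Z h h₀ Λ)
    (hΛ : 0 < Λ) (hρ : 0 < ρ) (hR : 0 < R) (δ : D2DMode) {τ : ℝ} (hτ : 0 < τ) :
    seIntegrand P δ 0 0 ρ R 4 Z h τ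
      = Real.exp (-(Real.pi ^ 2 / 2 * Λ * R ^ 2 * √τ)) / (1 + τ) := by
  have hR4 : 0 < R ^ (4 : ℝ) := Real.rpow_pos_of_pos hR 4
  rw [seIntegrand, henv.laplaceInterference_eq hΛ hρ (by positivity), laplace_exponent_eq hρ]
  simp [div_eq_inv_mul]

lemma IsD2DEnvironment.measure_lt_sinr (henv : IsD2DEnvironment P Z h h₀ Λ)
    (hΛ : 0 < Λ) (hρ : 0 < ρ) (hR : 0 < R) (δ : D2DMode) {τ : ℝ} (hτ : 0 < τ) :
    P {ω | τ < sinr δ 0 0 ρ R 4 Z h h₀ ω}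
      = ENNReal.ofReal (Real.exp (-(Real.pi ^ 2 / 2 * Λ * R ^ 2 * √τ))) := by
  have hR4 : 0 < R ^ (4 : ℝ) := Real.rpow_pos_of_pos hR 4
  rw [← laplace_exponent_eq hρ, ← henv.measure_mul_interference_lt hΛ hρ (by positivity)]
  refine measure_congr ?_
  -- Both null events must go: if I is 0 or ∞, its real value is 0 and the quotient is 0, so τ < Υ
  -- fails, whereas the other inequality reads 0 < h₀.
  filter_upwards [henv.interference_lt_top hΛ hρ, henv.interference_ne_zero hΛ hρ] with ω h1 h2
  have hI : 0 < (interference ρ 4 Z h ω).toReal := ENNReal.toReal_pos h2 h1.ne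
  refine propext ?_
  change τ < sinr δ 0 0 ρ R 4 Z h h₀ ω ↔
    τ * R ^ (4 : ℝ) / ρ * (interference ρ 4 Z h ω).toReal < h₀ ω
  rw [sinr_eq hρ hR, lt_div_iff₀ (by positivity)]
  ring_nf

/-- Layer-cake formula with weight 1 / (1 + t), whose primitive is log(1 + t). Working with the
lower integral yields integrability and value together. -/
lemma IsD2DEnvironment.lintegral_log_one_add_sinr (henv : IsD2DEnvironment P Z h h₀ Λ)
    (hΛ : 0 < Λ) (hρ : 0 < ρ) (hR : 0 < R) (δ : D2DMode) :
    ∫⁻ ω, ENNReal.ofReal (Real.log (1 + sinr δ 0 0 ρ R 4 Z h h₀ ω)) ∂P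
      = ENNReal.ofReal (2 * auxCos (Real.pi ^ 2 / 2 * Λ * R ^ 2)) := by
  have hT : 0 < Real.pi ^ 2 / 2 * Λ * R ^ 2 := by positivity
  have hnn := henv.sinr_nonneg hρ hR δ
  have hcake := lintegral_comp_eq_lintegral_meas_lt_mul P (g := fun t : ℝ => (1 + t)⁻¹) hnn
    (henv.measurable_sinr hρ hR δ).aemeasurable
    (fun t ht => ContinuousOn.intervalIntegrable (ContinuousOn.inv₀ (by fun_prop) fun x hx => by
      rw [uIcc_of_le ht.le] at hx
      linarith [hx.1]))
    ((ae_restrict_mem measurableSet_Ioi).mono fun t ht => by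
      have := mem_Ioi.1 ht
      positivity)
  have e1 : ∫⁻ ω, ENNReal.ofReal (Real.log (1 + sinr δ 0 0 ρ R 4 Z h h₀ ω)) ∂P
      = ∫⁻ ω, ENNReal.ofReal (∫ t in (0 : ℝ)..sinr δ 0 0 ρ R 4 Z h h₀ ω, (1 + t)⁻¹) ∂P :=
    lintegral_congr_ae (hnn.mono fun ω hω => by simp only [integral_inv_one_add hω])
  rw [e1, hcake, ← integral_exp_sqrt_div, ofReal_integral_eq_lintegral_ofReal
    (integrableOn_exp_sqrt_div hT)]
  · refine setLIntegral_congr_fun measurableSet_Ioi fun τ hτ => ?_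
    simp only [henv.measure_lt_sinr hΛ hρ hR δ hτ]
    rw [← ENNReal.ofReal_mul (Real.exp_pos _).le, div_eq_mul_inv _ (1 + τ)]
  · refine (ae_restrict_mem measurableSet_Ioi).mono fun t ht => ?_
    have := mem_Ioi.1 ht
    simp only [Pi.zero_apply]
    positivity

lemma IsD2DEnvironment.integrable_log_and_integral (henv : IsD2DEnvironment P Z h h₀ Λ)
    (hΛ : 0 < Λ) (hρ : 0 < ρ) (hR : 0 < R) (δ : D2DMode) :
    Integrable (fun ω => Real.log (1 + sinr δ 0 0 ρ R 4 Z h h₀ ω)) P ∧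
    ∫ ω, Real.log (1 + sinr δ 0 0 ρ R 4 Z h h₀ ω) ∂P
      = 2 * auxCos (Real.pi ^ 2 / 2 * Λ * R ^ 2) := by
  have hm : Measurable fun ω => Real.log (1 + sinr δ 0 0 ρ R 4 Z h h₀ ω) :=
    ((henv.measurable_sinr hρ hR δ).const_add 1).log
  have hnn : 0 ≤ᵐ[P] fun ω => Real.log (1 + sinr δ 0 0 ρ R 4 Z h h₀ ω) :=
    (henv.sinr_nonneg hρ hR δ).mono fun ω hω => Real.log_nonneg (by linarith)
  have hl := henv.lintegral_log_one_add_sinr hΛ hρ hR δ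
  refine ⟨⟨hm.aestronglyMeasurable, ?_⟩, ?_⟩
  · rw [hasFiniteIntegral_iff_ofReal hnn, hl]
    exact ENNReal.ofReal_lt_top
  · rw [integral_eq_lintegral_of_nonneg_ae hnn hm.aestronglyMeasurable, hl, ENNReal.toReal_ofReal]
    rw [auxCos]
    refine mul_nonneg two_pos.le (setIntegral_nonneg measurableSet_Ioi fun x hx => ?_)
    have := mem_Ioi.1 hx
    positivity

end SpectralEfficiency

theorem corollary2 {Ω : Type*} [MeasurableSpace Ω] (P : Measure Ω) [IsProbabilityMeasure P]
    (δ : D2DMode) (lam μ p ρ R σ2 α β : ℝ)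
    (hlam : 0 < lam) (hμ : 0 < μ) (hp : 0 < p) (hρ : 0 < ρ) (hR : 0 < R)
    (Z : ℕ → Ω → Plane) (h : ℕ → Ω → ℝ) (h₀ : Ω → ℝ)
    (henv : IsD2DEnvironment P Z h h₀ (μ * p * lam))
    (hσ : σ2 = 0) (hα : α = 4) (hβ : β = 0)
    (T : ℝ) (hT : T = Real.pi ^ 2 / 2 * μ * p * lam * R ^ 2) :
    -- the improper integral that defines `ci T` converges
    Tendsto (fun b : ℝ => ∫ t in T..b, Real.cos t / t) atTop (𝓝 (-ci T)) ∧
    -- the interference is almost surely finite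
    (∀ᵐ ω ∂P, interference ρ α Z h ω < ∞) ∧
    -- the spectral efficiency integral converges and has the closed form
    IntegrableOn (seIntegrand P δ σ2 β ρ R α Z h) (Ioi 0) ∧
    δ.kappa / Real.log 2 * ∫ τ in Ioi (0 : ℝ), seIntegrand P δ σ2 β ρ R α Z h τ
      = seClosedForm δ T ∧
    -- and so does the spectral efficiency itself
    Integrable (fun ω => Real.logb 2 (1 + sinr δ σ2 β ρ R α Z h h₀ ω)) P ∧
    spectralEfficiency P δ σ2 β ρ R α Z h h₀ = seClosedForm δ T := by
  subst hσ hα hβ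
  have hΛ : 0 < μ * p * lam := by positivity
  have hTeq : T = Real.pi ^ 2 / 2 * (μ * p * lam) * R ^ 2 := by rw [hT]; ring
  have hTpos : 0 < T := by rw [hTeq]; positivity
  -- Both the efficiency integral and the expectation reduce to 2 `auxCos T`, so each is matched
  -- with the closed form separately.
  have hse : EqOn (fun τ : ℝ => Real.exp (-(T * √τ)) / (1 + τ)) (seIntegrand P δ 0 0 ρ R 4 Z h)
      (Ioi 0) := fun τ hτ => by
    rw [henv.seIntegrand_eq hΛ hρ hR δ hτ, hTeq]
  obtain ⟨hint, hval⟩ := henv.integrable_log_and_integral hΛ hρ hR δ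
  rw [← hTeq] at hval
  refine ⟨?_, henv.interference_lt_top hΛ hρ,
    (integrableOn_exp_sqrt_div hTpos).congr_fun hse measurableSet_Ioi, ?_,
    hint.div_const (Real.log 2), ?_⟩
  · rw [ci_eq hTpos, neg_neg]
    exact tendsto_integral_cos_div hTpos
  · rw [← setIntegral_congr_fun measurableSet_Ioi hse, integral_exp_sqrt_div, seClosedForm,
      closedForm_eq_two_mul_auxCos hTpos]
  · simp only [spectralEfficiency, Real.logb]
    rw [integral_div, hval, seClosedForm, closedForm_eq_two_mul_auxCos hTpos]
    ring
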